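/- Each of the following nine Diophantine equations has exactly five solutions $(x,n)$ in non-negative integers, and the values of $n$ occurring in these solutions are exactly the ones listed: 1. $x^2=28\cdot 3^{n}+2997$, with $n=0,2,5,6,10$; 2. $x^2=70\cdot 3^{n}+414$, with $n=0,3,4,5,8$; 3. $x^2=130\cdot 3^{n}+5550606$, with $n=0,6,11,15,16$; 4. $x^2=148\cdot 3^{n}+41877$, with $n=0,5,6,9,17$; 5. $x^2=8740\cdot 3^{n}+57402189$, with $n=0,4,9,15,29$; 6. $x^2=6\cdot 5^{n}+11875$, with $n=0,4,5,6,9$; 7. $x^2=14\cdot 5^{n}+6875$, with $n=0,2,4,5,6$; 8. $x^2=248\cdot 6^{n}+23161$, with $n=0,1,3,4,5$; 9. $x^2=1513\cdot 6^{n}+19379701008$, with $n=0,7,9,10,12$. -/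

import Mathlib

/-- The set of solutions `(x, n)` in non-negative integers of the Diophantine equation
`x ^ 2 = A * k ^ n + B`. -/
def solutionSet (A k B : ℕ) : Set (ℕ × ℕ) :=
  {p | p.1 ^ 2 = A * k ^ p.2 + B}

/-- The equation `x ^ 2 = A * k ^ n + B` has exactly five solutions `(x, n)` in non-negative
integers, and `N` is the set of exponents `n` that occur in them. -/
def HasExactlyFiveSolutions (A k B : ℕ) (N : Set ℕ) : Prop :=
  (solutionSet A k B).ncard = 5 ∧ {n : ℕ | ∃ x : ℕ, (x, n) ∈ solutionSet A k B} = N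

/-! ### Solutions of `X ^ 2 = D * Z ^ 2 + N` below a bound, by reduction of binary forms -/

/-! The constant term is s² N. From exponent n₀ on, s² divides A kⁿ, so x = sX and, according to the
parity of n, X² = D Z² + N with Z = g k^l, for one of two values of D. Each of these is a Pell-type
equation. Powers of a norm-one u + v√D carry finitely many base solutions, those with Z below a
bound just above v√N, to all solutions with Z > 0 (`exists_base_mul_pow`). Along an orbit Z is
periodic modulo every m (`orbit_modEq`), as are suitable powers of g k^l; congruences chosen for
each orbit exclude every l ≥ L (`ne_of_orbitSieve`). The exponents below n₀ + 2L are checked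
directly. The base solutions must be known completely although the bound can exceed 10¹⁵.
`mem_of_formSearch` proves completeness by following the Euclidean algorithm on (X, Z) through a
pruned binary tree of equivalent forms. -/

/-- Evaluate a natural number before passing it on. -/
def forceNat {β : Sort*} (n : ℕ) (f : ℕ → β) : β :=
  -- Choosing a branch makes the kernel reduce `n`, so that unevaluated sums do not pile up during
  -- the search.
  match n with
  | 0 => f 0
  | m + 1 => f (m + 1)

/-- Evaluate an integer before passing it on. -/
def forceInt {β : Sort*} (a : ℤ) (f : ℤ → β) : β :=
  match a with
  | .ofNat n => forceNat n fun n => f (.ofNat n)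
  | .negSucc n => forceNat n fun n => f (.negSucc n)

@[simp] lemma forceNat_eq {β : Sort*} (n : ℕ) (f : ℕ → β) : forceNat n f = f n := by
  cases n <;> rfl

@[simp] lemma forceInt_eq {β : Sort*} (a : ℤ) (f : ℤ → β) : forceInt a f = f a := by
  cases a <;> simp [forceInt]

/-- Search the positive pairs `(x, y)` with `a x ^ 2 + b x y + c y ^ 2 = N` and `r x + s y < B`
by the subtractive Euclidean algorithm; the result is `true` only if all values `r x + s y`
belong to `zs`. -/
def formSearch (N : ℤ) (B : ℕ) (zs : List ℕ) : ℕ → ℤ → ℤ → ℤ → ℕ → ℕ → Bool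
  | 0, _, _, _, _, _ => false
  | fuel + 1, a, b, c, r, s =>
    forceInt (a + b + c) fun m => forceInt (2 * a + b) fun b₁ => forceInt (b + 2 * c) fun b₂ =>
    forceNat (r + s) fun t =>
      if B ≤ t then true
      else if 0 ≤ a ∧ 0 ≤ b ∧ 0 ≤ c ∧ N < m then true
      else if a ≤ 0 ∧ b ≤ 0 ∧ c ≤ 0 then true
      else (if m = N then zs.contains t else true) &&
        (formSearch N B zs fuel a b₁ m r t && formSearch N B zs fuel m b₂ c t s)

/-- A pair with x > y comes from (x - y, y), one with x < y from (x, y - x); the two recursive calls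
carry the substituted forms, and `r`, `s` keep the tracked linear form equal to its original value.
The value at (1, 1) is m = a + b + c, a lower bound for all values when the coefficients are
nonnegative, which justifies the pruning. -/
theorem mem_of_formSearch {N : ℤ} {B : ℕ} {zs : List ℕ} (hN : 0 < N) (hsq : Squarefree N)
    {fuel : ℕ} {a b c : ℤ} {r s : ℕ} (h : formSearch N B zs fuel a b c r s = true) {x y : ℕ}
    (hx : 0 < x) (hy : 0 < y) (hxy : a * x ^ 2 + b * x * y + c * y ^ 2 = N)
    (hB : r * x + s * y < B) : r * x + s * y ∈ zs := by
  induction fuel generalizing a b c r s x y with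
  | zero => simp [formSearch] at h
  | succ fuel ih =>
    have hx' : (1 : ℤ) ≤ x := by exact_mod_cast hx
    have hy' : (1 : ℤ) ≤ y := by exact_mod_cast hy
    simp only [formSearch, forceInt_eq, forceNat_eq] at h
    split_ifs at h with h1 h2 h3
    · exfalso
      have : r * 1 + s * 1 ≤ r * x + s * y := by gcongr <;> assumption
      omega
    · exfalso
      obtain ⟨ha, hb, hc, hm⟩ := h2
      have e1 : a * 1 ≤ a * (x : ℤ) ^ 2 := by gcongr; nlinarith
      have e2 : b * 1 ≤ b * ((x : ℤ) * y) := by gcongr; nlinarith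
      have e3 : c * 1 ≤ c * (y : ℤ) ^ 2 := by gcongr; nlinarith
      linarith
    · exfalso
      obtain ⟨ha, hb, hc⟩ := h3
      have e1 : a * (x : ℤ) ^ 2 ≤ 0 := mul_nonpos_of_nonpos_of_nonneg ha (by positivity)
      have e2 : b * ((x : ℤ) * y) ≤ 0 := mul_nonpos_of_nonpos_of_nonneg hb (by positivity)
      have e3 : c * (y : ℤ) ^ 2 ≤ 0 := mul_nonpos_of_nonpos_of_nonneg hc (by positivity)
      linarith
    all_goals
      simp only [Bool.and_eq_true] at h
      obtain ⟨h0, hl, hr⟩ := h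
      rcases lt_trichotomy x y with hlt | heq | hgt
      · obtain ⟨w, rfl⟩ := Nat.exists_eq_add_of_lt hlt
        have := ih hr (x := x) (y := w + 1) hx (by omega)
          (by push_cast at hxy ⊢; linear_combination hxy) (by nlinarith)
        convert this using 1; ring
      · subst heq
        -- On the diagonal the form is m x², so squarefreeness of N leaves only x = 1.
        have hu : IsUnit (x : ℤ) := hsq x ⟨a + b + c, by linear_combination -hxy⟩
        have hx1 : x = 1 := by
          rcases Int.isUnit_iff.mp hu with h | h <;> omega
        subst hx1
        simp_all
      · obtain ⟨w, rfl⟩ := Nat.exists_eq_add_of_lt hgt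
        have := ih hl (x := w + 1) (y := y) (by omega) hy
          (by push_cast at hxy ⊢; linear_combination hxy) (by nlinarith)
        convert this using 1; ring

/-- The list `zs` contains every positive `Z < B` for which `D * Z ^ 2 + N` is a square. -/
def CoversBelow (D N B : ℕ) (zs : List ℕ) : Prop :=
  ∀ X Z : ℕ, 0 < Z → Z < B → X ^ 2 = D * Z ^ 2 + N → Z ∈ zs

theorem squarefree_of_lt_sq {N : ℕ} (b : ℕ)
    (h : 0 < N ∧ N < b * b ∧ ∀ d < b, d * d ∣ N → d = 1) : Squarefree N := by
  intro d hd
  have hle := Nat.le_of_dvd h.1 hd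
  exact Nat.isUnit_iff.mpr (h.2.2 d (Nat.mul_self_lt_mul_self_iff.mp (hle.trans_lt h.2.1)) hd)

theorem coversBelow_of_formSearch {D N B : ℕ} {zs : List ℕ} (fuel : ℕ) (hN : 0 < N)
    (hsq : Squarefree N) (h : formSearch N B zs fuel 1 0 (-D) 0 1 = true) :
    CoversBelow D N B zs := by
  intro X Z hZ hB hX
  have hX0 : 0 < X := by
    rcases Nat.eq_zero_or_pos X with rfl | h
    · simp at hX; omega
    · exact h
  have hX' : (X : ℤ) ^ 2 = D * Z ^ 2 + N := by exact_mod_cast hX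
  simpa using mem_of_formSearch (by exact_mod_cast hN) (Int.squarefree_natCast.mpr hsq) h hX0 hZ
    (by linear_combination hX') (by simpa using hB)

/-- If every solution satisfies `X ≡ -r * Z` modulo `N` for some `r` in `rs`, then it suffices to
represent `1` by the forms `(N, -2 * r, (r ^ 2 - D) / N)`. -/
theorem coversBelow_of_roots {D N B : ℕ} {zs : List ℕ} (fuel : ℕ) (rs : List ℕ) (hN : 0 < N)
    (hrs : ∀ X Z : ℕ, X ^ 2 = D * Z ^ 2 + N → ∃ r ∈ rs, N ∣ X + r * Z)
    (h : (rs.all fun r => ((r : ℤ) ^ 2 - D) % N == 0 &&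
      formSearch 1 B zs fuel N (-2 * r) (((r : ℤ) ^ 2 - D) / N) 0 1) = true) :
    CoversBelow D N B zs := by
  intro X Z hZ hB hX
  obtain ⟨r, hr, y, hy⟩ := hrs X Z hX
  have hr' := List.all_eq_true.mp h r hr
  simp only [Bool.and_eq_true, beq_iff_eq] at hr'
  obtain ⟨hmod, hs⟩ := hr'
  have hy0 : 0 < y := by
    rcases Nat.eq_zero_or_pos y with rfl | h
    · have : X = 0 := by omega
      subst this
      simp at hX; omega
    · exact h
  have hX' : (X : ℤ) ^ 2 = D * Z ^ 2 + N := by exact_mod_cast hX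
  have hy' : (X : ℤ) + r * Z = N * y := by exact_mod_cast hy
  have hc := Int.mul_ediv_cancel' (Int.dvd_of_emod_eq_zero hmod)
  set c := ((r : ℤ) ^ 2 - D) / N
  have hN' : (N : ℤ) ≠ 0 := by exact_mod_cast hN.ne'
  -- Put X = N y - r Z in the equation and divide by N. The target is now 1, which is trivially
  -- squarefree and prunes sooner.
  have key : (N : ℤ) * y ^ 2 + -2 * r * y * Z + c * Z ^ 2 = 1 := by
    apply mul_left_cancel₀ hN'
    have hXe : (X : ℤ) = N * y - r * Z := by linarith
    rw [hXe] at hX'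
    linear_combination hX' + (Z : ℤ) ^ 2 * hc
  simpa using mem_of_formSearch one_pos squarefree_one hs hy0 hZ key (by simpa using hB)

/-! ### Orbits under a solution of Pell's equation -/

/-- Every solution of `X ^ 2 = D * Z ^ 2 + N` with `Z > 0` lies in the orbit of a solution with
`Z < B` under multiplication by `u + v √D`. -/
theorem exists_base_mul_pow {D N B u v : ℕ} {zs : List ℕ} (hcov : CoversBelow D N B zs)
    (huv : u ^ 2 = D * v ^ 2 + 1) (hD : 0 < D) (hv : 0 < v)
    (hN : 0 < N) (hB : v ^ 2 * N < B ^ 2) {X Z : ℕ}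
    (hZ : 0 < Z) (hX : X ^ 2 = D * Z ^ 2 + N) :
    ∃ x z : ℕ, z ∈ zs ∧ x ^ 2 = D * z ^ 2 + N ∧
      ∃ j : ℕ, (⟨X, Z⟩ : ℤ√(D : ℤ)) = ⟨x, z⟩ * ⟨u, v⟩ ^ j := by
  induction Z using Nat.strong_induction_on generalizing X with
  | _ Z ih =>
    rcases lt_or_ge Z B with hlt | hge
    · exact ⟨X, Z, hcov X Z hZ hlt hX, hX, 0, by simp⟩
    · have hZB : v ^ 2 * N < Z ^ 2 := hB.trans_le (Nat.pow_le_pow_left hge 2)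
      -- Descent: multiply by u - v√D. This inequality and the next make both new components
      -- positive.
      have h1 : v * X < u * Z := by
        apply lt_of_pow_lt_pow_left₀ 2 (Nat.zero_le _)
        rw [mul_pow, mul_pow, hX, huv]
        nlinarith
      have h2 : D * v * Z < u * X := by
        apply lt_of_pow_lt_pow_left₀ 2 (Nat.zero_le _)
        rw [mul_pow, mul_pow, mul_pow, hX, huv]
        have : 0 < (D * v ^ 2 + 1) * N := by positivity
        nlinarith [Nat.zero_le (D * Z ^ 2)]
      obtain ⟨Z', hZ'⟩ := Nat.exists_eq_add_of_lt h1
      obtain ⟨X', hX'⟩ := Nat.exists_eq_add_of_lt h2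
      have hX0 : (X : ℤ) ^ 2 = D * Z ^ 2 + N := by exact_mod_cast hX
      have hu0 : (u : ℤ) ^ 2 = D * v ^ 2 + 1 := by exact_mod_cast huv
      have hZ0 : (u : ℤ) * Z = v * X + Z' + 1 := by exact_mod_cast hZ'
      have hX1 : (u : ℤ) * X = D * v * Z + X' + 1 := by exact_mod_cast hX'
      have hnorm : (X' + 1) ^ 2 = D * (Z' + 1) ^ 2 + N := by
        have e1 : (X' : ℤ) + 1 = u * X - D * v * Z := by linarith
        have e2 : (Z' : ℤ) + 1 = u * Z - v * X := by linarith
        zify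
        rw [e1, e2]
        linear_combination ((u : ℤ) ^ 2 - D * v ^ 2) * hX0 + (N : ℤ) * hu0
      -- Otherwise vX ≤ (u - 1)Z; squaring and using D v² = u² - 1 gives (u² - 1)Z² < (u - 1)²Z²,
      -- impossible for u > 1.
      have hlt : Z' + 1 < Z := by
        by_contra hcon
        push Not at hcon
        have hu1 : 1 < u := by
          have : 0 < D * v ^ 2 := by positivity
          by_contra hu
          have : u ^ 2 ≤ 1 := by interval_cases u <;> norm_num
          omega
        have h3 : (v * X) ≤ (u - 1) * Z := by
          have : (u - 1) * Z + Z = u * Z := by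
            obtain ⟨w, rfl⟩ := Nat.exists_eq_add_of_lt hu1
            simp; ring
          omega
        obtain ⟨w, rfl⟩ := Nat.exists_eq_add_of_lt hu1
        have h4 : v * X ≤ (w + 1) * Z := by
          have e : 1 + w + 1 - 1 = w + 1 := by omega
          rwa [e] at h3
        have h5 : (v * X) ^ 2 ≤ ((w + 1) * Z) ^ 2 := Nat.pow_le_pow_left h4 2
        rw [mul_pow, mul_pow, hX] at h5
        nlinarith
      obtain ⟨x, z, hz, hxz, j, hj⟩ := ih (Z' + 1) hlt (Nat.succ_pos _) hnorm
      refine ⟨x, z, hz, hxz, j + 1, ?_⟩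
      rw [pow_succ, ← mul_assoc, ← hj]
      ext
      · simp
        linear_combination (-(X : ℤ)) * hu0 + (u : ℤ) * hX1 + (D * v : ℤ) * hZ0
      · simp
        linear_combination (-(Z : ℤ)) * hu0 + (v : ℤ) * hX1 + (u : ℤ) * hZ0

/-! ### Sieving the orbits -/

/-- The product in `ℤ√D`, with components reduced modulo `m`. -/
def mulMod (D m : ℕ) (P Q : ℕ × ℕ) : ℕ × ℕ :=
  forceNat ((P.1 * Q.1 + D * P.2 * Q.2) % m) fun a =>
  forceNat ((P.1 * Q.2 + P.2 * Q.1) % m) fun b => (a, b)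

/-- Binary powers in `ℤ√D` modulo `m`; the first argument bounds the exponent. -/
def powModAux (D m : ℕ) : ℕ → ℕ × ℕ → ℕ → ℕ × ℕ
  | 0, _, _ => (1, 0)
  | fuel + 1, P, n =>
    match n with
    | 0 => (1, 0)
    | n' + 1 =>
      let Q := powModAux D m fuel (mulMod D m P P) ((n' + 1) / 2)
      if (n' + 1) % 2 = 1 then mulMod D m Q P else Q

/-- The power `P ^ n` in `ℤ√D` modulo `m`. -/
def powMod (D m : ℕ) (P : ℕ × ℕ) (n : ℕ) : ℕ × ℕ := powModAux D m n P n

/-- The element of `ℤ√D` with components `P`. -/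
def toZsqrtd (D : ℕ) (P : ℕ × ℕ) : ℤ√(D : ℤ) := ⟨P.1, P.2⟩

theorem dvd_toZsqrtd_mulMod (D m : ℕ) (P Q : ℕ × ℕ) :
    ((m : ℤ) : ℤ√(D : ℤ)) ∣ toZsqrtd D P * toZsqrtd D Q - toZsqrtd D (mulMod D m P Q) := by
  rw [Zsqrtd.intCast_dvd]
  simp only [mulMod, forceNat_eq, toZsqrtd, Zsqrtd.re_sub, Zsqrtd.re_mul, Zsqrtd.im_sub,
    Zsqrtd.im_mul, Int.natCast_mod, Nat.cast_add, Nat.cast_mul]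
  exact ⟨Int.dvd_self_sub_emod, Int.dvd_self_sub_emod⟩

theorem dvd_mul_sub_toZsqrtd_mulMod {D m : ℕ} {P Q : ℕ × ℕ} {a b : ℤ√(D : ℤ)}
    (ha : ((m : ℤ) : ℤ√(D : ℤ)) ∣ a - toZsqrtd D P)
    (hb : ((m : ℤ) : ℤ√(D : ℤ)) ∣ b - toZsqrtd D Q) :
    ((m : ℤ) : ℤ√(D : ℤ)) ∣ a * b - toZsqrtd D (mulMod D m P Q) := by
  have h := dvd_add (dvd_add (dvd_mul_of_dvd_left ha b)
    (dvd_mul_of_dvd_right hb (toZsqrtd D P))) (dvd_toZsqrtd_mulMod D m P Q)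
  convert h using 1
  ring

theorem dvd_pow_sub_powModAux {D m : ℕ} {fuel n : ℕ} (hn : n ≤ fuel) {P : ℕ × ℕ}
    {a : ℤ√(D : ℤ)} (ha : ((m : ℤ) : ℤ√(D : ℤ)) ∣ a - toZsqrtd D P) :
    ((m : ℤ) : ℤ√(D : ℤ)) ∣ a ^ n - toZsqrtd D (powModAux D m fuel P n) := by
  have h1 : toZsqrtd D (1, 0) = 1 := by ext <;> simp [toZsqrtd]
  induction fuel generalizing n P a with
  | zero =>
    obtain rfl : n = 0 := by omega
    simp [powModAux, h1]
  | succ fuel ih =>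
    cases n with
    | zero => simp [powModAux, h1]
    | succ k =>
      have hsq := dvd_mul_sub_toZsqrtd_mulMod ha ha
      have hQ := ih (n := (k + 1) / 2) (by omega) hsq
      simp only [powModAux]
      split_ifs with hodd
      · have h := dvd_mul_sub_toZsqrtd_mulMod hQ ha
        convert h using 2
        rw [← pow_two, ← pow_mul, ← pow_succ]
        congr 1
        omega
      · convert hQ using 2
        rw [← pow_two, ← pow_mul]
        congr 1
        omega

theorem dvd_pow_sub_powMod {D m n : ℕ} (P : ℕ × ℕ) :
    ((m : ℤ) : ℤ√(D : ℤ)) ∣ toZsqrtd D P ^ n - toZsqrtd D (powMod D m P n) :=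
  dvd_pow_sub_powModAux le_rfl (by simp)

/-- The `j`-th element of the orbit of `(x, z)` under `u + v √D`, modulo `m`. -/
def orbitMod (D m : ℕ) (uv xz : ℕ × ℕ) (j : ℕ) : ℕ := (mulMod D m xz (powMod D m uv j)).2

/-- Refine a list of classes `(j mod A, l mod C)`, keeping the classes for which the
`j`-th element of the orbit can be `g * k ^ (L + l)`. Each step multiplies `A` by `α` and `C`
by `γ` and compares `e`-th powers modulo `m`. The result is `true` if no class is left. -/
def orbitSieve (D : ℕ) (uv xz : ℕ × ℕ) (g k L : ℕ) :
    List (ℕ × ℕ × ℕ × ℕ) → ℕ → ℕ → List (ℕ × ℕ) → Bool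
  | [], _, _, pairs => pairs.isEmpty
  | (α, γ, m, e) :: steps, A, C, pairs =>
    forceNat (A * α) fun A' => forceNat (C * γ) fun C' =>
    decide (0 < α) && decide (0 < γ) &&
    (powMod D m uv A').1 % m == 1 % m && (powMod D m uv A').2 % m == 0 &&
    (g * k ^ L) ^ e % m == (g * k ^ (L + C')) ^ e % m &&
    orbitSieve D uv xz g k L steps A' C'
      (pairs.flatMap fun p => (List.range α).flatMap fun i => (List.range γ).flatMap fun t =>
        forceNat (p.1 + A * i) fun j => forceNat (p.2 + C * t) fun l =>
          if orbitMod D m uv xz j ^ e % m = (g * k ^ (L + l)) ^ e % m then [(j, l)] else [])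

/-- The two checks say that (u + v√D)^A ≡ 1 modulo m in ℤ√D, so only j mod A matters. -/
theorem orbit_modEq {D m A : ℕ} {uv xz : ℕ × ℕ} (h1 : (powMod D m uv A).1 % m = 1 % m)
    (h2 : (powMod D m uv A).2 % m = 0) {j : ℕ} {X Z : ℕ}
    (hj : toZsqrtd D (X, Z) = toZsqrtd D xz * toZsqrtd D uv ^ j) :
    Z ≡ orbitMod D m uv xz (j % A) [MOD m] := by
  have hA : ((m : ℤ) : ℤ√(D : ℤ)) ∣ toZsqrtd D uv ^ A - 1 := by
    have h := dvd_pow_sub_powMod (D := D) (m := m) (n := A) uv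
    have h' : ((m : ℤ) : ℤ√(D : ℤ)) ∣ toZsqrtd D (powMod D m uv A) - 1 := by
      rw [Zsqrtd.intCast_dvd]
      simp only [toZsqrtd, Zsqrtd.re_sub, Zsqrtd.re_one, Zsqrtd.im_sub, Zsqrtd.im_one, sub_zero]
      refine ⟨?_, by exact_mod_cast Nat.dvd_of_mod_eq_zero h2⟩
      have h1' : 1 ≡ (powMod D m uv A).1 [MOD m] := Eq.symm h1
      exact_mod_cast h1'.dvd
    simpa using dvd_add h h'
  have hpow : ((m : ℤ) : ℤ√(D : ℤ)) ∣ toZsqrtd D uv ^ j - toZsqrtd D uv ^ (j % A) := by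
    have e : toZsqrtd D uv ^ j = (toZsqrtd D uv ^ A) ^ (j / A) * toZsqrtd D uv ^ (j % A) := by
      rw [← pow_mul, ← pow_add, Nat.div_add_mod]
    have h := hA.trans (sub_dvd_pow_sub_pow (toZsqrtd D uv ^ A) 1 (j / A))
    rw [one_pow] at h
    rw [e]
    convert dvd_mul_of_dvd_left h (toZsqrtd D uv ^ (j % A)) using 1
    ring
  have hm : ((m : ℤ) : ℤ√(D : ℤ)) ∣
      toZsqrtd D uv ^ j - toZsqrtd D (powMod D m uv (j % A)) := by
    simpa using dvd_add hpow (dvd_pow_sub_powMod (n := j % A) uv)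
  have h := dvd_mul_sub_toZsqrtd_mulMod (a := toZsqrtd D xz) (P := xz) (by simp) hm
  rw [← hj, Zsqrtd.intCast_dvd] at h
  exact (Nat.modEq_iff_dvd.mpr h.2).symm

/-- If equality held, the class of the actual (j, l) would survive every refinement, but the final
list is empty. -/
theorem ne_of_orbitSieve {D : ℕ} {uv xz : ℕ × ℕ} {g k L : ℕ} {steps : List (ℕ × ℕ × ℕ × ℕ)}
    {A C : ℕ} {pairs : List (ℕ × ℕ)} (h : orbitSieve D uv xz g k L steps A C pairs = true)
    {j l X Z : ℕ} (hA : 0 < A) (hC : 0 < C) (hp : (j % A, l % C) ∈ pairs)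
    (hj : toZsqrtd D (X, Z) = toZsqrtd D xz * toZsqrtd D uv ^ j) : Z ≠ g * k ^ (L + l) := by
  induction steps generalizing A C pairs with
  | nil => simp_all [orbitSieve]
  | cons s steps ih =>
    obtain ⟨α, γ, m, e⟩ := s
    simp only [orbitSieve, forceNat_eq, Bool.and_eq_true, decide_eq_true_eq, beq_iff_eq] at h
    obtain ⟨⟨⟨⟨⟨hα, hγ⟩, h1⟩, h2⟩, h3⟩, hrec⟩ := h
    intro hZ
    refine ih hrec (by positivity) (by positivity) ?_ hZ
    have hZm := orbit_modEq h1 h2 hj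
    have hper : ∀ q : ℕ, (g * k ^ (L + l % (C * γ))) ^ e ≡
        (g * k ^ (L + (l % (C * γ) + C * γ * q))) ^ e [MOD m] := by
      intro q
      induction q with
      | zero => rfl
      | succ q ihq =>
        refine ihq.trans ?_
        have h3' : (g * k ^ L) ^ e ≡ (g * k ^ (L + C * γ)) ^ e [MOD m] := h3
        -- The period is checked only at l = 0; multiplying by a power of k transports it to every
        -- l.
        have := h3'.mul_right ((k ^ (l % (C * γ) + C * γ * q)) ^ e)
        convert this using 1 <;> ring
    simp only [List.mem_flatMap, List.mem_range]
    refine ⟨_, hp, j / A % α, Nat.mod_lt _ hα, l / C % γ, Nat.mod_lt _ hγ, ?_⟩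
    simp only [← Nat.mod_mul]
    rw [if_pos]
    · simp
    · have h4 := hper (l / (C * γ))
      rw [Nat.mod_add_div, ← hZ] at h4
      exact ((hZm.pow e).symm.trans h4.symm)

/-- A solution `uv` of Pell's equation, together with representatives of the orbits of solutions of
`X ^ 2 = D * Z ^ 2 + N` and a sieve showing that no `Z = g * k ^ l` with `L ≤ l` occurs. -/
theorem sq_ne_of_sieve {D N B g k L : ℕ} {uv : ℕ × ℕ}
    (bases : List ((ℕ × ℕ) × List (ℕ × ℕ × ℕ × ℕ)))
    (hcov : CoversBelow D N B (bases.map fun b => b.1.2))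
    (hpos : 0 < D ∧ 0 < N ∧ 0 < uv.2 ∧ 0 < g ∧ 0 < k ∧ uv.1 ^ 2 = D * uv.2 ^ 2 + 1 ∧
      uv.2 ^ 2 * N < B ^ 2)
    (h : (bases.all fun b => b.1.1 ^ 2 == D * b.1.2 ^ 2 + N &&
      orbitSieve D uv b.1 g k L b.2 1 1 [(0, 0)]) = true)
    {X l : ℕ} (hl : L ≤ l) : X ^ 2 ≠ D * (g * k ^ l) ^ 2 + N := by
  intro hX
  obtain ⟨hD, hN, hv, hg, hk, huv, hB⟩ := hpos
  obtain ⟨x, z, hz, hxz, j, hj⟩ :=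
    exists_base_mul_pow hcov huv hD hv hN hB (by positivity) hX
  obtain ⟨⟨⟨x', z'⟩, steps⟩, hb, rfl⟩ := List.mem_map.mp hz
  have hb' := List.all_eq_true.mp h _ hb
  simp only [Bool.and_eq_true, beq_iff_eq] at hb' hxz hj
  obtain ⟨hx', hs⟩ := hb'
  obtain rfl : x = x' := Nat.pow_left_injective two_ne_zero (hxz.trans hx'.symm)
  obtain ⟨l', rfl⟩ := Nat.exists_eq_add_of_le hl
  exact ne_of_orbitSieve hs (j := j) (l := l') (X := X) one_pos one_pos
    (by simp [Nat.mod_one]) hj rfl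

/-! ### Assembling the solution sets -/

theorem sq_ne_of_dvd {M s N D Z X : ℕ} (hs : 0 < s) (hM : M = s ^ 2 * (D * Z ^ 2 + N))
    (h : ∀ Y : ℕ, Y ^ 2 ≠ D * Z ^ 2 + N) : X ^ 2 ≠ M := by
  rintro rfl
  obtain ⟨Y, rfl⟩ : s ∣ X := (Nat.pow_dvd_pow_iff two_ne_zero).mp ⟨_, hM⟩
  refine h Y (Nat.eq_of_mul_eq_mul_left (pow_pos hs 2) ?_)
  rw [← hM, mul_pow]

/-- `roots` lists the integer parts of the square roots of `A * k ^ n + B` for `n < n₀ + 2 * L`,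
and the larger exponents are treated by parity. -/
theorem hasExactlyFiveSolutions_of_parity {A k B s N n₀ L D₀ g₀ D₁ g₁ : ℕ} {S : Finset ℕ}
    {S' : Set ℕ} (roots : List ℕ) (hS : (S : Set ℕ) = S') (hcard : S.card = 5)
    (hsmall : ∀ n < n₀ + 2 * L, roots.getD n 0 ^ 2 ≤ A * k ^ n + B ∧
      A * k ^ n + B < (roots.getD n 0 + 1) ^ 2 ∧
      (n ∈ S ↔ roots.getD n 0 ^ 2 = A * k ^ n + B))
    (hlarge : ∀ n ∈ S, n < n₀ + 2 * L)
    (hs : 0 < s ∧ B = s ^ 2 * N ∧ A * k ^ n₀ = s ^ 2 * D₀ * g₀ ^ 2 ∧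
      A * k ^ (n₀ + 1) = s ^ 2 * D₁ * g₁ ^ 2)
    (heven : ∀ X l : ℕ, L ≤ l → X ^ 2 ≠ D₀ * (g₀ * k ^ l) ^ 2 + N)
    (hodd : ∀ X l : ℕ, L ≤ l → X ^ 2 ≠ D₁ * (g₁ * k ^ l) ^ 2 + N) :
    HasExactlyFiveSolutions A k B S' := by
  obtain ⟨hs0, hB, h0, h1⟩ := hs
  have hiff : ∀ n : ℕ, (∃ x : ℕ, x ^ 2 = A * k ^ n + B) ↔ n ∈ S := by
    intro n
    rcases lt_or_ge n (n₀ + 2 * L) with hn | hn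
    · obtain ⟨hle, hlt, hmem⟩ := hsmall n hn
      rw [hmem]
      refine ⟨?_, fun h => ⟨_, h⟩⟩
      rintro ⟨x, hx⟩
      rw [← hx] at hle hlt ⊢
      have h1 := (Nat.pow_le_pow_iff_left two_ne_zero).mp hle
      have h2 := (Nat.pow_lt_pow_iff_left two_ne_zero).mp hlt
      rw [show roots.getD n 0 = x by omega]
    · refine ⟨?_, fun h => absurd (hlarge n h) (by omega)⟩
      rintro ⟨x, hx⟩
      exfalso
      obtain ⟨i, rfl⟩ := Nat.exists_eq_add_of_le (show n₀ ≤ n by omega)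
      rcases Nat.even_or_odd' i with ⟨l, rfl | rfl⟩
      · refine sq_ne_of_dvd hs0 ?_ (fun Y => heven Y l (by omega)) hx
        rw [pow_add, ← mul_assoc, h0, hB]
        ring
      · refine sq_ne_of_dvd hs0 ?_ (fun Y => hodd Y l (by omega)) hx
        rw [show n₀ + (2 * l + 1) = n₀ + 1 + 2 * l by ring, pow_add, ← mul_assoc, h1, hB]
        ring
  have himage : {n : ℕ | ∃ x : ℕ, (x, n) ∈ solutionSet A k B} = S := by
    ext n
    exact hiff n
  refine ⟨?_, himage.trans hS⟩
  -- Since x ≥ 0 is determined by n, solutions are counted by their exponents.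
  have hinj : Set.InjOn Prod.snd (solutionSet A k B) := by
    rintro ⟨x, n⟩ hx ⟨y, _⟩ hy rfl
    exact Prod.ext (Nat.pow_left_injective two_ne_zero (Eq.trans hx hy.symm)) rfl
  rw [← hinj.ncard_image, ← hcard, ← Set.ncard_coe_finset, ← himage]
  congr 1
  ext n
  simp

/-! ### The nine equations -/

/-! ### Square roots of D modulo N, prime by prime. -/

theorem dvd_add_or_dvd_add_of_sq {D N p r r' X Z : ℕ} (hp : p.Prime) (hN : p ∣ N)
    (hr : r ^ 2 ≡ D [MOD p]) (hr' : r + r' = p) (h : X ^ 2 = D * Z ^ 2 + N) :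
    p ∣ X + r * Z ∨ p ∣ X + r' * Z := by
  have hmul : (p : ℤ) ∣ ((X : ℤ) + r * Z) * (X - r * Z) := by
    obtain ⟨t, ht⟩ := hr.dvd
    push_cast at ht
    obtain ⟨w, rfl⟩ := hN
    have h' : (X : ℤ) ^ 2 = D * Z ^ 2 + p * w := by exact_mod_cast h
    exact ⟨w + t * Z ^ 2, by linear_combination h' + (Z : ℤ) ^ 2 * ht⟩
  rcases (Nat.prime_iff_prime_int.mp hp).dvd_or_dvd hmul with h | h
  · exact Or.inl (by exact_mod_cast h)
  · right
    have : (p : ℤ) ∣ X + r' * Z := by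
      have e : (r : ℤ) + r' = p := by exact_mod_cast hr'
      obtain ⟨w, hw⟩ := h
      exact ⟨w + Z, by linear_combination hw + (Z : ℤ) * e⟩
    exact_mod_cast this

/-- Chinese remainder gluing of a root modulo p with a root modulo M. -/
theorem exists_root_mul {X Z p M a b : ℕ} {rs rs' : List ℕ}
    (hp : p ∣ X + a * Z ∨ p ∣ X + b * Z) (hM : ∃ r ∈ rs, M ∣ X + r * Z) (hco : Nat.Coprime p M)
    (h : ∀ r ∈ rs, (∃ r' ∈ rs', r' ≡ a [MOD p] ∧ r' ≡ r [MOD M]) ∧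
      ∃ r' ∈ rs', r' ≡ b [MOD p] ∧ r' ≡ r [MOD M]) :
    ∃ r' ∈ rs', p * M ∣ X + r' * Z := by
  obtain ⟨r, hr, hrM⟩ := hM
  have key : ∀ c r' : ℕ, p ∣ X + c * Z → r' ≡ c [MOD p] → r' ≡ r [MOD M] →
      p * M ∣ X + r' * Z := fun c r' hc h1 h2 =>
    hco.mul_dvd_of_dvd_of_dvd
      ((((h1.mul_right Z).add_left X).dvd_iff dvd_rfl).mpr hc)
      ((((h2.mul_right Z).add_left X).dvd_iff dvd_rfl).mpr hrM)
  rcases hp with hp | hp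
  · obtain ⟨r', hr', h1, h2⟩ := (h r hr).1
    exact ⟨r', hr', key a r' hp h1 h2⟩
  · obtain ⟨r', hr', h1, h2⟩ := (h r hr).2
    exact ⟨r', hr', key b r' hp h1 h2⟩

/-! ### Powers of 3. -/

theorem sq_ne_28_37 (X l : ℕ) (hl : 4 ≤ l) :
    X ^ 2 ≠ 28 * (1 * 3 ^ l) ^ 2 + 37 :=
  sq_ne_of_sieve (B := 146) (uv := (127, 24))
    -- As l ≥ 4, 81 divides 3^l, which restricts j modulo 27. Modulo 71 the exponent 35 gives the
    -- Legendre symbol, and 3 is a square there, so l drops out.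
    [((17, 3), [(27, 1, 81, 1), (1, 1, 71, 35)]),
     ((143, 27), [(27, 1, 81, 1), (2, 1, 431, 43)])]
    (coversBelow_of_formSearch 20 (by norm_num)
      (squarefree_of_lt_sq 7 (by decide +kernel)) (by decide +kernel))
    (by norm_num) (by decide +kernel) hl

theorem sq_ne_84_37 (X l : ℕ) (hl : 1 ≤ l) :
    X ^ 2 ≠ 84 * (1 * 3 ^ l) ^ 2 + 37 :=
  sq_ne_of_sieve (B := 37) (uv := (55, 6))
    [((11, 1), [(1, 1, 3, 1)]),
     ((101, 11), [(1, 1, 3, 1)])]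
    (coversBelow_of_formSearch 23 (by norm_num)
      (squarefree_of_lt_sq 7 (by decide +kernel)) (by decide +kernel))
    (by norm_num) (by decide +kernel) hl

theorem hasExactlyFiveSolutions_28_3_2997 :
    HasExactlyFiveSolutions 28 3 2997 {0, 2, 5, 6, 10} :=
  hasExactlyFiveSolutions_of_parity (S := {0, 2, 5, 6, 10}) (s := 9) (N := 37)
    -- `L` is the larger of the two thresholds.
    (n₀ := 4) (L := 4) (D₀ := 28) (g₀ := 1) (D₁ := 84) (g₁ := 1)
    [55, 55, 57, 61, 72, 99, 153, 253, 432, 744, 1287, 2227]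
    (by simp) rfl (by decide +kernel) (by decide) (by norm_num)
    (fun X l hl => sq_ne_28_37 X l (by omega))
    (fun X l hl => sq_ne_84_37 X l (by omega))

theorem sq_ne_70_46 (X l : ℕ) (hl : 4 ≤ l) :
    X ^ 2 ≠ 70 * (1 * 3 ^ l) ^ 2 + 46 :=
  sq_ne_of_sieve (B := 204) (uv := (251, 30))
    [((26, 3), [(54, 1, 81, 1), (1, 1, 271, 30)]),
     ((226, 27), [(54, 1, 81, 1), (1, 1, 271, 30)])]
    (coversBelow_of_formSearch 24 (by norm_num)
      (squarefree_of_lt_sq 7 (by decide +kernel)) (by decide +kernel))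
    (by norm_num) (by decide +kernel) hl

theorem sq_ne_210_46 (X l : ℕ) (hl : 2 ≤ l) :
    X ^ 2 ≠ 210 * (1 * 3 ^ l) ^ 2 + 46 :=
  sq_ne_of_sieve (B := 14) (uv := (29, 2))
    [((16, 1), [(18, 1, 9, 1), (1, 1, 59, 29)]),
     ((44, 3), [(18, 1, 9, 1), (1, 1, 181, 45)])]
    (coversBelow_of_formSearch 24 (by norm_num)
      (squarefree_of_lt_sq 7 (by decide +kernel)) (by decide +kernel))
    (by norm_num) (by decide +kernel) hl

theorem hasExactlyFiveSolutions_70_3_414 :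
    HasExactlyFiveSolutions 70 3 414 {0, 3, 4, 5, 8} :=
  hasExactlyFiveSolutions_of_parity (S := {0, 3, 4, 5, 8}) (s := 3) (N := 46)
    (n₀ := 2) (L := 4) (D₀ := 70) (g₀ := 1) (D₁ := 210) (g₁ := 1)
    [22, 24, 32, 48, 78, 132, 226, 391, 678, 1173]
    (by simp) rfl (by decide +kernel) (by decide) (by norm_num)
    (fun X l hl => sq_ne_70_46 X l (by omega))
    (fun X l hl => sq_ne_210_46 X l (by omega))

theorem sq_ne_130_94 (X l : ℕ) (hl : 4 ≤ l) :
    X ^ 2 ≠ 130 * (1 * 3 ^ l) ^ 2 + 94 :=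
  sq_ne_of_sieve (B := 5527) (uv := (6499, 570))
    [((308, 27), [(27, 1, 81, 1), (1, 1, 109, 27)]),
     ((992, 87), [(27, 2, 7, 3), (1, 1, 577, 24)])]
    (coversBelow_of_formSearch 52 (by norm_num)
      (squarefree_of_lt_sq 10 (by decide +kernel)) (by decide +kernel))
    (by norm_num) (by decide +kernel) hl

theorem sq_ne_390_94 (X l : ℕ) (hl : 3 ≤ l) :
    X ^ 2 ≠ 390 * (1 * 3 ^ l) ^ 2 + 94 :=
  sq_ne_of_sieve (B := 39) (uv := (79, 4))
    [((22, 1), [(27, 1, 27, 1), (4, 1, 71, 35), (1, 1, 229, 57)]),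
     ((178, 9), [(27, 1, 27, 1), (2, 4, 53, 13), (1, 1, 593, 148)])]
    (coversBelow_of_formSearch 34 (by norm_num)
      (squarefree_of_lt_sq 10 (by decide +kernel)) (by decide +kernel))
    (by norm_num) (by decide +kernel) hl

theorem hasExactlyFiveSolutions_130_3_5550606 :
    HasExactlyFiveSolutions 130 3 5550606 {0, 6, 11, 15, 16} :=
  hasExactlyFiveSolutions_of_parity (S := {0, 6, 11, 15, 16}) (s := 243) (N := 94)
    (n₀ := 10) (L := 4) (D₀ := 130) (g₀ := 1) (D₁ := 390) (g₁ := 1)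
    [2356, 2356, 2356, 2356, 2358, 2362, 2376, 2415, 2530, 2847, 3636, 5346, 8639, 14588,
    25046, 43254, 74844, 129590]
    (by simp) rfl (by decide +kernel) (by decide) (by norm_num)
    (fun X l hl => sq_ne_130_94 X l (by omega))
    (fun X l hl => sq_ne_390_94 X l (by omega))

theorem sq_ne_148_517 (X l : ℕ) (hl : 2 ≤ l) :
    X ^ 2 ≠ 148 * (1 * 3 ^ l) ^ 2 + 517 :=
  sq_ne_of_sieve (B := 137) (uv := (73, 6))
    [((43, 3), [(3, 1, 9, 1), (2, 2, 5, 2), (1, 1, 7, 3)]),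
     ((475, 39), [(3, 1, 9, 1), (2, 2, 5, 2), (1, 1, 29, 14)])]
    (coversBelow_of_formSearch 42 (by norm_num)
      (squarefree_of_lt_sq 23 (by decide +kernel)) (by decide +kernel))
    (by norm_num) (by decide +kernel) hl

theorem sq_ne_444_517 (X l : ℕ) (hl : 7 ≤ l) :
    X ^ 2 ≠ 444 * (1 * 3 ^ l) ^ 2 + 517 :=
  sq_ne_of_sieve (B := 319) (uv := (295, 14))
    [((31, 1), [(2187, 1, 2187, 1), (4, 1, 59, 29), (1, 1, 73, 12), (1, 1, 8747, 4373)]),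
     ((191, 9), [(2187, 1, 2187, 1), (1, 2, 7, 3), (1, 1, 4049, 2024)]),
     ((401, 19), [(2187, 1, 2187, 1), (1, 2, 7, 3), (1, 1, 53, 26)]),
     ((2929, 139), [(2187, 1, 2187, 1), (1, 2, 7, 3), (1, 1, 53, 26)])]
    (coversBelow_of_formSearch 59 (by norm_num)
      (squarefree_of_lt_sq 23 (by decide +kernel)) (by decide +kernel))
    (by norm_num) (by decide +kernel) hl

theorem hasExactlyFiveSolutions_148_3_41877 :
    HasExactlyFiveSolutions 148 3 41877 {0, 5, 6, 9, 17} :=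
  hasExactlyFiveSolutions_of_parity (S := {0, 5, 6, 9, 17}) (s := 9) (N := 517)
    (n₀ := 4) (L := 7) (D₀ := 148) (g₀ := 1) (D₁ := 444) (g₁ := 1)
    [205, 205, 207, 214, 232, 279, 387, 604, 1006, 1719, 2963, 5124, 8871, 15362, 26606, 46083,
    79818, 138249]
    (by simp) rfl (by decide +kernel) (by decide) (by norm_num)
    (fun X l hl => sq_ne_148_517 X l (by omega))
    (fun X l hl => sq_ne_444_517 X l (by omega))

theorem sq_ne_8740_8749 (X l : ℕ) (hl : 1 ≤ l) :
    X ^ 2 ≠ 8740 * (1 * 3 ^ l) ^ 2 + 8749 :=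
  sq_ne_of_sieve (B := 2502779598007186) (uv := (2501491975869079, 26757368380026))
    [((811943, 8685), [(6, 2, 7, 3), (1, 1, 11, 5), (1, 1, 29, 14)]),
     ((980951383, 10492809), [(4, 1, 9133, 2283)]),
     ((11155269097, 119323047), [(4, 1, 9133, 2283)]),
     ((13477272031097, 144160499403), [(6, 2, 7, 3), (1, 1, 11, 5), (1, 1, 29, 14)])]
    (coversBelow_of_formSearch 302 (by norm_num)
      (squarefree_of_lt_sq 94 (by decide +kernel)) (by decide +kernel))
    (by norm_num) (by decide +kernel) hl

theorem sq_ne_26220_8749 (X l : ℕ) (hl : 11 ≤ l) :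
    X ^ 2 ≠ 26220 * (1 * 3 ^ l) ^ 2 + 8749 :=
  sq_ne_of_sieve (B := 5520688) (uv := (9557191, 59022))
    [((187, 1), [(1, 1, 3, 1)]),
     ((4373, 27), [(2187, 1, 59049, 1), (1, 1, 47, 23)]),
     -- Here Z = 3^10 is the solution with n = 29, hence L = 11 and the extra step modulo 3^11.
     ((9561563, 59049), [(2187, 1, 59049, 1), (3, 1, 177147, 1), (1, 1, 52489, 2187)]),
     ((239637877, 1479923), [(1, 1, 3, 1)])]
    (coversBelow_of_formSearch 365 (by norm_num)
      (squarefree_of_lt_sq 94 (by decide +kernel)) (by decide +kernel))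
    (by norm_num) (by decide +kernel) hl

theorem hasExactlyFiveSolutions_8740_3_57402189 :
    HasExactlyFiveSolutions 8740 3 57402189 {0, 4, 9, 15, 29} :=
  hasExactlyFiveSolutions_of_parity (S := {0, 4, 9, 15, 29}) (s := 81) (N := 8749)
    (n₀ := 8) (L := 11) (D₀ := 8740) (g₀ := 1) (D₁ := 26220) (g₁ := 1)
    [7577, 7578, 7581, 7591, 7623, 7715, 7985, 8747, 10711, 15147, 23947, 40070, 68572, 118286,
    204598, 354213, 613421, 1062422, 1840139, 3187196, 5520376, 9561566, 16561114, 28684689,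
    49683339, 86054067, 149050016, 258162201, 447150048, 774486603]
    (by simp) rfl (by decide +kernel) (by decide) (by norm_num)
    (fun X l hl => sq_ne_8740_8749 X l (by omega))
    (fun X l hl => sq_ne_26220_8749 X l (by omega))

/-! ### Powers of 5. -/

theorem sq_ne_6_19 (X l : ℕ) (hl : 2 ≤ l) :
    X ^ 2 ≠ 6 * (1 * 5 ^ l) ^ 2 + 19 :=
  sq_ne_of_sieve (B := 9) (uv := (5, 2))
    [((5, 1), [(20, 1, 25, 1), (1, 1, 89, 44)]),
     ((13, 5), [(20, 1, 25, 1), (1, 1, 89, 44)])]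
    (coversBelow_of_formSearch 10 (by norm_num)
      (squarefree_of_lt_sq 5 (by decide +kernel)) (by decide +kernel))
    (by norm_num) (by decide +kernel) hl

theorem sq_ne_30_19 (X l : ℕ) (hl : 3 ≤ l) :
    X ^ 2 ≠ 30 * (1 * 5 ^ l) ^ 2 + 19 :=
  sq_ne_of_sieve (B := 9) (uv := (11, 2))
    [((7, 1), [(125, 1, 125, 1), (2, 1, 5501, 2750)]),
     ((17, 3), [(125, 1, 101, 25)])]
    (coversBelow_of_formSearch 13 (by norm_num)
      (squarefree_of_lt_sq 5 (by decide +kernel)) (by decide +kernel))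
    (by norm_num) (by decide +kernel) hl

theorem hasExactlyFiveSolutions_6_5_11875 :
    HasExactlyFiveSolutions 6 5 11875 {0, 4, 5, 6, 9} :=
  hasExactlyFiveSolutions_of_parity (S := {0, 4, 5, 6, 9}) (s := 25) (N := 19)
    (n₀ := 4) (L := 3) (D₀ := 6) (g₀ := 1) (D₁ := 30) (g₁ := 1)
    [109, 109, 109, 112, 125, 175, 325, 693, 1534, 3425]
    (by simp) rfl (by decide +kernel) (by decide) (by norm_num)
    (fun X l hl => sq_ne_6_19 X l (by omega))
    (fun X l hl => sq_ne_30_19 X l (by omega))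

theorem sq_ne_14_11 (X l : ℕ) (hl : 2 ≤ l) :
    X ^ 2 ≠ 14 * (1 * 5 ^ l) ^ 2 + 11 :=
  sq_ne_of_sieve (B := 14) (uv := (15, 4))
    [((5, 1), [(20, 1, 25, 1), (1, 1, 11, 5)]),
     ((19, 5), [(20, 1, 25, 1), (1, 1, 61, 30)])]
    (coversBelow_of_formSearch 11 (by norm_num)
      (squarefree_of_lt_sq 4 (by decide +kernel)) (by decide +kernel))
    (by norm_num) (by decide +kernel) hl

theorem sq_ne_70_11 (X l : ℕ) (hl : 1 ≤ l) :
    X ^ 2 ≠ 70 * (1 * 5 ^ l) ^ 2 + 11 :=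
  sq_ne_of_sieve (B := 100) (uv := (251, 30))
    [((9, 1), [(1, 1, 5, 1)]),
     ((159, 19), [(1, 1, 5, 1)])]
    (coversBelow_of_formSearch 20 (by norm_num)
      (squarefree_of_lt_sq 4 (by decide +kernel)) (by decide +kernel))
    (by norm_num) (by decide +kernel) hl

theorem hasExactlyFiveSolutions_14_5_6875 :
    HasExactlyFiveSolutions 14 5 6875 {0, 2, 4, 5, 6} :=
  hasExactlyFiveSolutions_of_parity (S := {0, 2, 4, 5, 6}) (s := 25) (N := 11)
    (n₀ := 4) (L := 2) (D₀ := 14) (g₀ := 1) (D₁ := 70) (g₁ := 1)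
    [83, 83, 85, 92, 125, 225, 475, 1049]
    (by simp) rfl (by decide +kernel) (by decide) (by norm_num)
    (fun X l hl => sq_ne_14_11 X l (by omega))
    (fun X l hl => sq_ne_70_11 X l (by omega))

/-! ### Powers of 6. -/

theorem sq_ne_248_23161 (X l : ℕ) (hl : 3 ≤ l) :
    X ^ 2 ≠ 248 * (1 * 6 ^ l) ^ 2 + 23161 :=
  sq_ne_of_sieve (B := 609) (uv := (63, 4))
    [((153, 1), [(1, 1, 2, 1)]),
     ((219, 10), [(2, 1, 4, 1)]),
     ((281, 15), [(1, 1, 2, 1)]),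
     ((587, 36), [(2, 1, 8, 1), (2, 1, 3, 1)]),
     ((1269, 80), [(2, 1, 8, 1), (2, 1, 3, 1)]),
     ((2823, 179), [(1, 1, 2, 1)]),
     ((3877, 246), [(2, 1, 4, 1)]),
     ((8647, 549), [(1, 1, 2, 1)])]
    (coversBelow_of_formSearch 172 (by norm_num)
      (squarefree_of_lt_sq 153 (by decide +kernel)) (by decide +kernel))
    (by norm_num) (by decide +kernel) hl

theorem sq_ne_1488_23161 (X l : ℕ) (hl : 3 ≤ l) :
    X ^ 2 ≠ 1488 * (1 * 6 ^ l) ^ 2 + 23161 :=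
  sq_ne_of_sieve (B := 47940) (uv := (12151, 315))
    [((157, 1), [(1, 1, 3, 1)]),
     ((277, 6), [(1, 1, 9, 1)]),
     ((1397, 36), [(8, 1, 8, 1), (3, 1, 71, 35)]),
     ((5981, 155), [(1, 1, 3, 1)]),
     ((23531, 610), [(1, 1, 3, 1)]),
     ((101027, 2619), [(1, 1, 5, 1)]),
     ((553507, 14349), [(1, 1, 9, 1)]),
     ((1438987, 37304), [(1, 1, 3, 1)])]
    (coversBelow_of_formSearch 206 (by norm_num)
      (squarefree_of_lt_sq 153 (by decide +kernel)) (by decide +kernel))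
    (by norm_num) (by decide +kernel) hl

theorem hasExactlyFiveSolutions_248_6_23161 :
    HasExactlyFiveSolutions 248 6 23161 {0, 1, 3, 4, 5} :=
  hasExactlyFiveSolutions_of_parity (S := {0, 1, 3, 4, 5}) (s := 1) (N := 23161)
    (n₀ := 0) (L := 3) (D₀ := 248) (g₀ := 1) (D₁ := 1488) (g₁ := 1)
    [153, 157, 179, 277, 587, 1397]
    (by simp) rfl (by decide +kernel) (by decide) (by norm_num)
    (fun X l hl => sq_ne_248_23161 X l (by omega))
    (fun X l hl => sq_ne_1488_23161 X l (by omega))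

/-- N = 23 · 29 · 47 · 53, so two roots modulo each prime combine to 16 roots modulo N. -/
theorem exists_root_1513 (X Z : ℕ) (h : X ^ 2 = 1513 * Z ^ 2 + 1661497) :
    ∃ r ∈ [35159, 139211, 149745, 253797, 592626, 665329, 707212, 779915, 881582, 954285,
    996168, 1068871, 1407700, 1511752, 1522286, 1626338], 1661497 ∣ X + r * Z := by
  have h23 := dvd_add_or_dvd_add_of_sq (p := 23) (r := 8) (r' := 15) (by norm_num)
    (by norm_num) (by norm_num) (by norm_num) h
  have h29 := dvd_add_or_dvd_add_of_sq (p := 29) (r := 11) (r' := 18) (by norm_num)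
    (by norm_num) (by norm_num) (by norm_num) h
  have h47 := dvd_add_or_dvd_add_of_sq (p := 47) (r := 3) (r' := 44) (by norm_num)
    (by norm_num) (by norm_num) (by norm_num) h
  have h53 := dvd_add_or_dvd_add_of_sq (p := 53) (r := 20) (r' := 33) (by norm_num)
    (by norm_num) (by norm_num) (by norm_num) h
  have e23 : ∃ r ∈ [8, 15], 23 ∣ X + r * Z :=
    exists_root_mul (M := 1) (rs := [0]) h23 ⟨0, List.mem_singleton_self 0, one_dvd _⟩ (by norm_num)
      (by decide +kernel)
  have e29 : ∃ r ∈ [192, 330, 337, 475], 667 ∣ X + r * Z :=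
    exists_root_mul (M := 23) h29 e23 (by norm_num) (by decide +kernel)
  have e47 : ∃ r ∈ [3005, 3810, 7000, 13815, 17534, 24349, 27539, 28344], 31349 ∣ X + r * Z :=
    exists_root_mul (M := 667) h47 e29 (by norm_num) (by decide +kernel)
  have e53 : ∃ r ∈ [35159, 139211, 149745, 253797, 592626, 665329, 707212, 779915, 881582,
      954285, 996168, 1068871, 1407700, 1511752, 1522286, 1626338], 1661497 ∣ X + r * Z :=
    exists_root_mul (M := 31349) h53 e47 (by norm_num) (by decide +kernel)
  exact e53

theorem sq_ne_1513_1661497 (X l : ℕ) (hl : 4 ≤ l) :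
    X ^ 2 ≠ 1513 * (2 * 6 ^ l) ^ 2 + 1661497 :=
  sq_ne_of_sieve (B := 738338023181) (uv := (22280499233, 572803224))
    [((3083, 72), [(4, 1, 32, 1), (27, 1, 5, 1)]),
     ((16853, 432), [(4, 1, 32, 1), (27, 1, 81, 1), (1, 1, 107, 106)]),
     ((228253, 5868), [(1, 1, 8, 1)]),
     ((27203683, 699372), [(1, 1, 8, 1)]),
     ((680403875, 17492316), [(1, 1, 8, 1)]),
     ((81092642333, 2084788428), [(1, 1, 8, 1)]),
     ((1099901515765, 28277065416), [(4, 1, 32, 1), (27, 1, 5, 1)]),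
     ((6291887125675, 161756394816), [(4, 1, 32, 1), (1, 1, 29, 14)])]
    (coversBelow_of_roots 221
      [35159, 139211, 149745, 253797, 592626, 665329, 707212, 779915, 881582, 954285, 996168,
      1068871, 1407700, 1511752, 1522286, 1626338]
      (by norm_num) exists_root_1513 (by decide +kernel))
    (by norm_num) (by decide +kernel) hl

theorem exists_root_9078 (X Z : ℕ) (h : X ^ 2 = 9078 * Z ^ 2 + 1661497) :
    ∃ r ∈ [52375, 85288, 196853, 229766, 547956, 686922, 692434, 830097, 831400, 969063,
    974575, 1113541, 1431731, 1464644, 1576209, 1609122], 1661497 ∣ X + r * Z := by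
  have h23 := dvd_add_or_dvd_add_of_sq (p := 23) (r := 4) (r' := 19) (by norm_num)
    (by norm_num) (by norm_num) (by norm_num) h
  have h29 := dvd_add_or_dvd_add_of_sq (p := 29) (r := 1) (r' := 28) (by norm_num)
    (by norm_num) (by norm_num) (by norm_num) h
  have h47 := dvd_add_or_dvd_add_of_sq (p := 47) (r := 17) (r' := 30) (by norm_num)
    (by norm_num) (by norm_num) (by norm_num) h
  have h53 := dvd_add_or_dvd_add_of_sq (p := 53) (r := 11) (r' := 42) (by norm_num)
    (by norm_num) (by norm_num) (by norm_num) h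
  have e23 : ∃ r ∈ [4, 19], 23 ∣ X + r * Z :=
    exists_root_mul (M := 1) (rs := [0]) h23 ⟨0, List.mem_singleton_self 0, one_dvd _⟩ (by norm_num)
      (by decide +kernel)
  have e29 : ∃ r ∈ [88, 318, 349, 579], 667 ∣ X + r * Z :=
    exists_root_mul (M := 23) h29 e23 (by norm_num) (by decide +kernel)
  have e47 : ∃ r ∈ [2756, 8759, 10323, 15023, 16326, 21026, 22590, 28593], 31349 ∣ X + r * Z :=
    exists_root_mul (M := 667) h47 e29 (by norm_num) (by decide +kernel)
  have e53 : ∃ r ∈ [52375, 85288, 196853, 229766, 547956, 686922, 692434, 830097, 831400,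
      969063, 974575, 1113541, 1431731, 1464644, 1576209, 1609122], 1661497 ∣ X + r * Z :=
    exists_root_mul (M := 31349) h53 e47 (by norm_num) (by decide +kernel)
  exact e53

theorem sq_ne_9078_1661497 (X l : ℕ) (hl : 2 ≤ l) :
    X ^ 2 ≠ 9078 * (2 * 6 ^ l) ^ 2 + 1661497 :=
  sq_ne_of_sieve (B := 5890241465) (uv := (435389957, 4569654))
    [((1303, 2), [(4, 1, 3, 1)]),
     ((1723, 12), [(12, 1, 9, 1), (1, 1, 5, 1)]),
     ((7355, 76), [(4, 1, 3, 1)]),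
     ((197993, 2078), [(4, 1, 3, 1)]),
     ((273643, 2872), [(4, 1, 3, 1)]),
     ((379973, 3988), [(4, 1, 3, 1)]),
     ((1934917, 20308), [(4, 1, 3, 1)]),
     ((4985545, 52326), [(12, 1, 9, 1), (1, 1, 5, 1)]),
     ((72549653, 761448), [(12, 1, 5, 1)]),
     ((186932873, 1961962), [(4, 1, 3, 1)]),
     ((951911305, 9990826), [(4, 1, 3, 1)]),
     ((1321800887, 13873018), [(4, 1, 3, 1)]),
     ((1826849365, 19173776), [(4, 1, 3, 1)]),
     ((49560888823, 520168438), [(4, 1, 3, 1)]),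
     ((252377067767, 2648834358), [(12, 1, 5, 1)]),
     ((484346475947, 5083479248), [(4, 1, 3, 1)])]
    (coversBelow_of_roots 869
      [52375, 85288, 196853, 229766, 547956, 686922, 692434, 830097, 831400, 969063, 974575,
      1113541, 1431731, 1464644, 1576209, 1609122]
      (by norm_num) exists_root_9078 (by decide +kernel))
    (by norm_num) (by decide +kernel) hl

theorem hasExactlyFiveSolutions_1513_6_19379701008 :
    HasExactlyFiveSolutions 1513 6 19379701008 {0, 7, 9, 10, 12} :=
  hasExactlyFiveSolutions_of_parity (S := {0, 7, 9, 10, 12}) (s := 108) (N := 1661497)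
    (n₀ := 6) (L := 4) (D₀ := 1513) (g₀ := 2) (D₁ := 9078) (g₁ := 2)
    [139211, 139211, 139211, 139212, 139218, 139253, 139464, 140724, 148057, 186084, 332964,
    753851, 1820124, 4447494]
    (by simp) rfl (by decide +kernel) (by decide) (by norm_num)
    (fun X l hl => sq_ne_1513_1661497 X l (by omega))
    (fun X l hl => sq_ne_9078_1661497 X l (by omega))

theorem mainTheorem3 :
    HasExactlyFiveSolutions 28 3 2997 {0, 2, 5, 6, 10} ∧
    HasExactlyFiveSolutions 70 3 414 {0, 3, 4, 5, 8} ∧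
    HasExactlyFiveSolutions 130 3 5550606 {0, 6, 11, 15, 16} ∧
    HasExactlyFiveSolutions 148 3 41877 {0, 5, 6, 9, 17} ∧
    HasExactlyFiveSolutions 8740 3 57402189 {0, 4, 9, 15, 29} ∧
    HasExactlyFiveSolutions 6 5 11875 {0, 4, 5, 6, 9} ∧
    HasExactlyFiveSolutions 14 5 6875 {0, 2, 4, 5, 6} ∧
    HasExactlyFiveSolutions 248 6 23161 {0, 1, 3, 4, 5} ∧
    HasExactlyFiveSolutions 1513 6 19379701008 {0, 7, 9, 10, 12} :=
  ⟨hasExactlyFiveSolutions_28_3_2997,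
   hasExactlyFiveSolutions_70_3_414,
   hasExactlyFiveSolutions_130_3_5550606,
   hasExactlyFiveSolutions_148_3_41877,
   hasExactlyFiveSolutions_8740_3_57402189,
   hasExactlyFiveSolutions_6_5_11875,
   hasExactlyFiveSolutions_14_5_6875,
   hasExactlyFiveSolutions_248_6_23161,
   hasExactlyFiveSolutions_1513_6_19379701008⟩
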